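/- Setting. Let $d\in\mathbb{N}$ and let $\{\psi_\lambda\}_{\lambda\in\Lambda}$ be a smooth (Meyer-type) orthonormal wavelet basis of the real space $L_2(\mathbb{R}^d)$, consisting of the integer translates of a scaling function ($|\lambda|=0$) and of the functions $2^{jd/2}\psi^e(2^j\cdot-k)$, $1\le e\le 2^d-1$, $j\ge 0$, $k\in\mathbb{Z}^d$ ($|\lambda|=j$), where the scaling function and the mother wavelets $\psi^e$ are Schwartz functions and all moments of the $\psi^e$ vanish. For $s\in\mathbb{R}$, $0<p<\infty$ let $B^s_p=B^s_{p,p}(\mathbb{R}^d)$ be the space of real tempered distributions $u=\sum_\lambda u_\lambda\psi_\lambda$ (unconditional convergence in $\mathcal{S}'$), $u_\lambda=\langle u,\psi_\lambda\rangle$, with $$\|u\|_{B^s_p}=\Big(\sum_{\lambda\in\Lambda}2^{p(s+d(\frac12-\frac1p))|\lambda|}\,|u_\lambda|^p\Big)^{1/p}<\infty ,$$ put $\|u\|_{B^s_p}=\infty$ for $u\notin B^s_p$, and let $H^s=B^s_2$. Let $\mathcal{B}_X=B^{s_X}_{p_X}$ for $X\in\{D,S,G,R\}$. Theorem. Let $s_D,s_S,s_G\in\mathbb{R}$,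 $p_D>1$ and $0<p_S\le p_G<\infty$. Let $F:\mathcal{B}_D\to L_2(\mathbb{R}^d)$ be linear and continuous and suppose that its adjoint satisfies $\mathcal{B}_G\subset\operatorname{rg}F^*$ (for instance $\operatorname{rg}F^*=\mathcal{B}_G$), where elements of $\mathcal{B}_D^*$ are identified with the tempered distributions they induce on Schwartz functions. Let $\mathcal{B}_S\subset\mathcal{B}_D$, $u^\dagger\in\mathcal{B}_S$ and $v=Fu^\dagger$. Let $$p_R=\frac{p_S+p_G}{p_G},\qquad s_R\le\frac{p_Ss_S-p_Gs_G}{p_S+p_G},\qquad \sigma=s_R+d\Big(\frac12-\frac1{p_R}\Big).$$ Then for all constants $c,C>0$ there are $K>0$ and $\delta_0>0$ such that for all $0<\delta\le\delta_0$, all $\alpha$ with $c\,\delta\le\alpha\le C\,\delta$, all $v^\delta\in L_2(\mathbb{R}^d)$ with $\|v-v^\delta\|_{L_2}\le\delta$ and every minimizer $u^{\alpha,\delta}$ over $\mathcal{B}_D$ of $$T_\alpha(u)=\|Fu-v^\delta\|_{L_2}^2+\alpha\,\|u\|_{\mathcal{B}_R}^{p_R}\in[0,\infty],$$ we have $u^{\alpha,\delta}-u^\dagger\in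 H^\sigma$ and $\|u^{\alpha,\delta}-u^\dagger\|_{H^\sigma}\le K\sqrt\delta$. -/

import Mathlib

open MeasureTheory Filter Topology
open scoped ENNReal SchwartzMap

noncomputable section

namespace BesovTikhonov

/-- Euclidean space `ℝ^d`. -/
abbrev Space (d : ℕ) : Type := EuclideanSpace ℝ (Fin d)

/-- The space `𝓢'(ℝ^d)` of real-valued tempered distributions. -/
abbrev Distr (d : ℕ) : Type := 𝓢(Space d, ℝ) →L[ℝ] ℝ

/-- The real Lebesgue space `L₂(ℝ^d)`. -/
abbrev LTwo (d : ℕ) : Type := Lp ℝ 2 (volume : Measure (Space d))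

/-- The lattice point `k ∈ ℤ^d` as a vector of `ℝ^d`. -/
def latticePoint {d : ℕ} (k : Fin d → ℤ) : Space d :=
  WithLp.toLp 2 (fun i => (k i : ℝ))

/-- The dilation `x ↦ 2^j x` of `ℝ^d`. -/
def dilation (d j : ℕ) : Space d ≃L[ℝ] Space d :=
  ContinuousLinearEquiv.smulLeft (Units.mk0 ((2 : ℝ) ^ j) (by positivity))

/-- The function `x ↦ 2^(j d / 2) f (2^j x - k)`, as a Schwartz function. -/
def dilateTranslate {d : ℕ} (f : 𝓢(Space d, ℝ)) (j : ℕ) (k : Fin d → ℤ) : 𝓢(Space d, ℝ) :=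
  ((2 : ℝ) ^ ((j : ℝ) * (d : ℝ) / 2)) •
    SchwartzMap.compCLMOfContinuousLinearEquiv ℝ (dilation d j)
      (SchwartzMap.compSubConstCLM ℝ (latticePoint k) f)

theorem dilateTranslate_apply {d : ℕ} (f : 𝓢(Space d, ℝ)) (j : ℕ) (k : Fin d → ℤ) (x : Space d) :
    dilateTranslate f j k x =
      (2 : ℝ) ^ ((j : ℝ) * (d : ℝ) / 2) * f ((2 : ℝ) ^ j • x - latticePoint k) := by
  rfl

/-- The index set `Λ` of an inhomogeneous wavelet basis of `L₂(ℝ^d)`: translates `k ∈ ℤ^d` of the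
scaling function, and triples `(e, j, k)` for the `2^d - 1` mother wavelets, the scales `j ≥ 0` and
the translations `k ∈ ℤ^d`. -/
inductive Index (d : ℕ) : Type
  | scaling (k : Fin d → ℤ) : Index d
  | wavelet (e : Fin (2 ^ d - 1)) (j : ℕ) (k : Fin d → ℤ) : Index d

/-- The scale `|λ|` of an index `λ ∈ Λ`. -/
def Index.scale {d : ℕ} : Index d → ℕ
  | .scaling _ => 0
  | .wavelet _ j _ => j

/-- The functions generated by a scaling function and mother wavelets. -/
def waveletFamily {d : ℕ} (father : 𝓢(Space d, ℝ)) (mother : Fin (2 ^ d - 1) → 𝓢(Space d, ℝ)) :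
    Index d → 𝓢(Space d, ℝ)
  | .scaling k => dilateTranslate father 0 k
  | .wavelet e j k => dilateTranslate (mother e) j k

/-- A smooth orthonormal wavelet basis of `L₂(ℝ^d)` (of Meyer type): the scaling function and the
mother wavelets are real Schwartz functions, all moments of the mother wavelets vanish, and the
generated family is an orthonormal basis of `L₂(ℝ^d)`. -/
structure WaveletBasis (d : ℕ) where
  father : 𝓢(Space d, ℝ)
  mother : Fin (2 ^ d - 1) → 𝓢(Space d, ℝ)
  moment_eq_zero : ∀ (e : Fin (2 ^ d - 1)) (n : Fin d → ℕ),
    ∫ x : Space d, (∏ i, x i ^ n i) * mother e x = 0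
  orthonormal : Orthonormal ℝ
    (fun i : Index d => ((waveletFamily father mother i).toLp 2 volume : LTwo d))
  complete : (Submodule.span ℝ (Set.range
    (fun i : Index d => ((waveletFamily father mother i).toLp 2 volume : LTwo d)))).topologicalClosure
      = ⊤

/-- The wavelet `ψ_λ`. -/
def WaveletBasis.psi {d : ℕ} (W : WaveletBasis d) (i : Index d) : 𝓢(Space d, ℝ) :=
  waveletFamily W.father W.mother i

/-- The factor `2^((s + d (1/2 - 1/p)) |λ|)`. -/
def weight {d : ℕ} (s p : ℝ) (i : Index d) : ℝ :=
  (2 : ℝ) ^ ((s + (d : ℝ) * (1 / 2 - 1 / p)) * (i.scale : ℝ))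

/-- The Besov space `B^s_{p,p}(ℝ^d)` for `s ∈ ℝ`, `0 < p < ∞`: the tempered distributions `u` whose
wavelet coefficients `u_λ = ⟨u, ψ_λ⟩` satisfy
`∑_λ 2^(p (s + d (1/2 - 1/p)) |λ|) |u_λ|^p < ∞` and which are the sum of their wavelet series
`∑_λ u_λ ψ_λ`, with unconditional convergence in `𝓢'`. -/
def Besov {d : ℕ} (W : WaveletBasis d) (s p : ℝ) : Submodule ℝ (Distr d) where
  carrier := {u |
    Memℓp (fun i : Index d => weight s p i * u (W.psi i)) (ENNReal.ofReal p) ∧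
    ∀ φ : 𝓢(Space d, ℝ),
      HasSum (fun i : Index d => u (W.psi i) * ∫ x, W.psi i x * φ x) (u φ)}
  zero_mem' := by
    refine ⟨?_, fun φ => ?_⟩
    · have h := zero_memℓp (E := fun _ : Index d => ℝ) (p := ENNReal.ofReal p)
      convert h using 1
      funext i
      exact mul_zero _
    · have h : HasSum (fun _ : Index d => (0 : ℝ)) 0 := hasSum_zero
      convert h using 1
      · funext i
        exact zero_mul _
      · rfl
  add_mem' := by
    rintro u v ⟨hu, hu'⟩ ⟨hv, hv'⟩
    refine ⟨?_, fun φ => ?_⟩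
    · have h := hu.add hv
      convert h using 1
      funext i
      simp [mul_add]
    · have h := (hu' φ).add (hv' φ)
      simpa [add_mul] using h
  smul_mem' := by
    rintro c u ⟨hu, hu'⟩
    refine ⟨?_, fun φ => ?_⟩
    · have h := hu.const_mul c
      have e : (fun i : Index d => weight s p i * (c • u) (W.psi i)) =
          fun i => c * (weight s p i * u (W.psi i)) := by
        funext i
        exact mul_left_comm (weight s p i) c (u (W.psi i))
      exact e ▸ h
    · have h := (hu' φ).mul_left c
      simpa [mul_assoc] using h

/-- The Besov norm
`‖u‖ = (∑_λ 2^(p (s + d (1/2 - 1/p)) |λ|) |u_λ|^p)^(1/p)`, to be used for `u ∈ B^s_{p,p}`. -/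
def besovNorm {d : ℕ} (W : WaveletBasis d) (s p : ℝ) (u : Distr d) : ℝ :=
  (∑' i : Index d,
    (2 : ℝ) ^ (p * (s + (d : ℝ) * (1 / 2 - 1 / p)) * (i.scale : ℝ)) * |u (W.psi i)| ^ p) ^ (1 / p)

open Classical in
/-- The Besov norm extended to all tempered distributions by `∞` outside of `B^s_{p,p}`. -/
def besovENorm {d : ℕ} (W : WaveletBasis d) (s p : ℝ) (u : Distr d) : ℝ≥0∞ :=
  if u ∈ Besov W s p then ENNReal.ofReal (besovNorm W s p u) else ⊤

/-- Continuity of a linear operator `F : B^s_{p,p} → L₂`. -/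
def IsBoundedOp {d : ℕ} (W : WaveletBasis d) {s p : ℝ} (F : Besov W s p →ₗ[ℝ] LTwo d) : Prop :=
  ∃ M : ℝ, ∀ u : Besov W s p, ‖F u‖ ≤ M * besovNorm W s p (u : Distr d)

/-- The range of the adjoint `F^* : L₂ → (B^s_{p,p})^*` of `F : B^s_{p,p} → L₂`. As usual, a
functional on `B^s_{p,p}` is identified with the tempered distribution that it induces on the
Schwartz functions (which form a dense subspace of `B^s_{p,p}`), so `F^* w` is the tempered
distribution `φ ↦ ⟨w, F φ⟩`. -/
def adjointRange {d : ℕ} (W : WaveletBasis d) {s p : ℝ} (F : Besov W s p →ₗ[ℝ] LTwo d) :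
    Set (Distr d) :=
  {g | ∃ w : LTwo d, ∀ (φ : 𝓢(Space d, ℝ)) (u : Besov W s p),
    (∀ χ : 𝓢(Space d, ℝ), (u : Distr d) χ = ∫ x, φ x * χ x) → g φ = inner ℝ w (F u)}

/-- The Tikhonov functional `T_α(u) = ‖F u - v^δ‖² + α ‖u‖_{B_R}^{p_R}` on `B_D`, with values in
`[0, ∞]`, where `B_R = B^{s_R}_{p_R,p_R}`. -/
def tikhonov {d : ℕ} (W : WaveletBasis d) {sD pD : ℝ} (F : Besov W sD pD →ₗ[ℝ] LTwo d)
    (sR pR α : ℝ) (vδ : LTwo d) (u : Besov W sD pD) : ℝ≥0∞ :=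
  ENNReal.ofReal (‖F u - vδ‖ ^ 2) + ENNReal.ofReal α * besovENorm W sR pR (u : Distr d) ^ pR

end BesovTikhonov

end

noncomputable section

namespace BesovTikhonov

/-! The argument is variational regularization with a source condition. In wavelet coordinates the
penalty is `∑ |X_λ|^p_R`, where `X_λ` is the coefficient times the `B_R` weight; write `A` for the
same sequence at `u†`. Since `p_R - 1 = p_S / p_G`, the subgradient of the penalty at `u† ∈ B_S`
lies in `B_G` (`summable_subgradient`), hence equals `F^* w` for some `w`.

Comparing a minimizer with `u†` bounds `‖Fu - v^δ‖²` plus `α` times the Bregman distance by `δ² -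
α⟨w, Fu - v⟩`. Young's inequality and `α ∼ δ` then make the Bregman distance `O(δ)`
(`bregman_rate`). As `p_R ≤ 2` and the sequences are bounded, that distance dominates a multiple of
`∑ (X_λ - A_λ)²` (`summable_sq_sub_of_bregman`), which is the squared `H^σ` norm by the choice of
`σ`.

Two facts about distributions are needed. The subgradient, given only by its coefficients, must be a
tempered distribution; this follows from rapid decay of wavelet coefficients of Schwartz functions
(`WaveletBasis.exists_hasSum`). And `F^* w`, known only on Schwartz functions, must be paired with
elements of `B_D`; this is done by truncating wavelet series (`hasSum_of_adjointRange`). -/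

/-! ### Taylor expansion of Schwartz functions. -/

theorem iteratedDeriv_comp_line {E : Type*} [NormedAddCommGroup E] [NormedSpace ℝ E] {φ : E → ℝ}
    (hφ : ContDiff ℝ (⊤ : ℕ∞) φ) (x z : E) (n : ℕ) (t : ℝ) :
    iteratedDeriv n (fun t : ℝ => φ (x + t • z)) t =
      iteratedFDeriv ℝ n φ (x + t • z) (fun _ => z) := by
  have hx : ContDiff ℝ (⊤ : ℕ∞) (fun y => φ (x + y)) := hφ.comp (by fun_prop)
  have h := ContinuousLinearMap.iteratedFDeriv_comp_right
    ((ContinuousLinearMap.id ℝ ℝ).smulRight z) hx t (i := n) (by exact_mod_cast le_top)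
  have e : (fun t : ℝ => φ (x + t • z)) =
      (fun y => φ (x + y)) ∘ ((ContinuousLinearMap.id ℝ ℝ).smulRight z) := by
    funext t; simp
  rw [iteratedDeriv_eq_iteratedFDeriv, e, h, iteratedFDeriv_comp_add_left]
  simp

/-- **Taylor's theorem** along a segment, with the Lagrange form of the remainder. -/
theorem exists_taylor_segment {E : Type*} [NormedAddCommGroup E] [NormedSpace ℝ E] {φ : E → ℝ}
    (hφ : ContDiff ℝ (⊤ : ℕ∞) φ) (x z : E) (N : ℕ) :
    ∃ t ∈ Set.Icc (0 : ℝ) 1, φ (x + z) =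
      ∑ n ∈ Finset.range N, (n.factorial : ℝ)⁻¹ * iteratedFDeriv ℝ n φ x (fun _ => z) +
        (N.factorial : ℝ)⁻¹ * iteratedFDeriv ℝ N φ (x + t • z) (fun _ => z) := by
  cases N with
  | zero => exact ⟨1, by simp, by simp⟩
  | succ n =>
    have hg : ContDiff ℝ (⊤ : ℕ∞) (fun t : ℝ => φ (x + t • z)) := hφ.comp (by fun_prop)
    obtain ⟨t, ht, h⟩ := taylor_mean_remainder_lagrange_iteratedDeriv
      (f := fun t : ℝ => φ (x + t • z)) (x := 1) (x₀ := 0) (n := n) zero_ne_one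
      (hg.contDiffOn.of_le (by exact_mod_cast le_top))
    rw [Set.uIoo_of_le zero_le_one] at ht
    refine ⟨t, Set.Ioo_subset_Icc_self ht, ?_⟩
    rw [iteratedDeriv_comp_line hφ, taylor_within_apply] at h
    have e : ∀ k ∈ Finset.range (n + 1),
        (((k.factorial : ℝ)⁻¹ * (1 - 0) ^ k) • iteratedDerivWithin k (fun t : ℝ => φ (x + t • z))
          (Set.uIcc 0 1) 0) = (k.factorial : ℝ)⁻¹ * iteratedFDeriv ℝ k φ x (fun _ => z) := by
      intro k _
      rw [iteratedDerivWithin_eq_iteratedDeriv (uniqueDiffOn_uIcc zero_ne_one)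
        (hg.contDiffAt.of_le (by exact_mod_cast le_top)) (by simp), iteratedDeriv_comp_line hφ]
      simp
    rw [Finset.sum_congr rfl e] at h
    simp only [one_smul, sub_zero, one_pow, mul_one] at h
    rw [eq_add_of_sub_eq' h]
    ring

theorem taylor_remainder_le {d : ℕ} (φ : 𝓢(Space d, ℝ)) (N M : ℕ) (x z : Space d) :
    (1 + ‖x‖) ^ M * |φ (x + z) -
        ∑ n ∈ Finset.range N, (n.factorial : ℝ)⁻¹ * iteratedFDeriv ℝ n φ x (fun _ => z)| ≤
      2 ^ M * (Finset.Iic (M, N)).sup (schwartzSeminormFamily ℝ (Space d) ℝ) φ *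
        ((1 + ‖z‖) ^ M * ‖z‖ ^ N) := by
  obtain ⟨t, ht, h⟩ := exists_taylor_segment (φ.smooth ⊤) x z N
  set y := x + t • z with hy
  -- Moves the weight from `x` to the intermediate point `y`, where the Schwartz seminorm controls
  -- the derivative.
  have hxy : 1 + ‖x‖ ≤ (1 + ‖y‖) * (1 + ‖z‖) := by
    have h1 : ‖x‖ ≤ ‖y‖ + ‖z‖ := by
      have h2 : x = y - t • z := by simp [hy]
      calc ‖x‖ ≤ ‖y‖ + ‖t • z‖ := by rw [h2]; exact norm_sub_le _ _
        _ ≤ _ := by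
          rw [norm_smul, Real.norm_of_nonneg ht.1]
          gcongr
          exact mul_le_of_le_one_left (norm_nonneg _) ht.2
    nlinarith [mul_nonneg (norm_nonneg y) (norm_nonneg z)]
  have hφ := SchwartzMap.one_add_le_sup_seminorm_apply (𝕜 := ℝ) (m := (M, N)) le_rfl le_rfl φ y
  have hr : |(N.factorial : ℝ)⁻¹ * iteratedFDeriv ℝ N φ y (fun _ => z)| ≤
      ‖iteratedFDeriv ℝ N φ y‖ * ‖z‖ ^ N := by
    rw [abs_mul]
    have h1 : |(N.factorial : ℝ)⁻¹| ≤ 1 := by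
      rw [abs_of_nonneg (by positivity)]
      exact inv_le_one_of_one_le₀ (by exact_mod_cast N.factorial_pos)
    have h2 := (iteratedFDeriv ℝ N φ y).le_opNorm (fun _ => z)
    simp only [Finset.prod_const, Finset.card_univ, Fintype.card_fin, Real.norm_eq_abs] at h2
    exact (mul_le_of_le_one_left (abs_nonneg _) h1).trans h2
  rw [h, add_sub_cancel_left]
  calc _ ≤ ((1 + ‖y‖) * (1 + ‖z‖)) ^ M * (‖iteratedFDeriv ℝ N φ y‖ * ‖z‖ ^ N) := by gcongr
    _ = (1 + ‖y‖) ^ M * ‖iteratedFDeriv ℝ N φ y‖ * ((1 + ‖z‖) ^ M * ‖z‖ ^ N) := by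
      rw [mul_pow]; ring
    _ ≤ _ := mul_le_mul_of_nonneg_right hφ (by positivity)

/-! ### Vanishing moments and decay of wavelet coefficients. -/

/-- The moments of `f` of order less than `N` vanish. -/
def HasVanishingMoments {d : ℕ} (f : 𝓢(Space d, ℝ)) (N : ℕ) : Prop :=
  ∀ n : Fin d → ℕ, ∑ i, n i < N → ∫ x : Space d, (∏ i, x i ^ n i) * f x = 0

theorem integrable_multilinear_mul {d n : ℕ} (f : 𝓢(Space d, ℝ))
    (m : ContinuousMultilinearMap ℝ (fun _ : Fin n => Space d) ℝ) :
    Integrable (fun y : Space d => m (fun _ => y) * f y) := by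
  have hm : Continuous fun y : Space d => m (fun _ => y) := m.cont.comp (by fun_prop)
  refine ((f.integrable_pow_mul volume n).const_mul ‖m‖).mono'
    ((hm.mul f.continuous).aestronglyMeasurable) (Eventually.of_forall fun y => ?_)
  rw [norm_mul, ← mul_assoc]
  gcongr
  simpa using m.le_opNorm (fun _ => y)

/-- Expanding in coordinates turns `m (y, …, y)` into a combination of monomials of total degree
`n`; the exponent of `y i` is the number of slots assigned to `i`. -/
theorem integral_multilinear_mul_eq_zero {d n N : ℕ} {f : 𝓢(Space d, ℝ)}
    (hf : HasVanishingMoments f N) (hn : n < N)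
    (m : ContinuousMultilinearMap ℝ (fun _ : Fin n => Space d) ℝ) :
    ∫ y : Space d, m (fun _ => y) * f y = 0 := by
  classical
  let e : Fin d → Space d := fun i => EuclideanSpace.single i 1
  have hy : ∀ y : Space d, y = ∑ i, y i • e i := fun y => by
    ext j
    simp [e, Finset.sum_apply, Pi.single_apply]
  have h1 : ∀ y : Space d, m (fun _ => y) * f y =
      ∑ r : Fin n → Fin d, m (fun i => e (r i)) * ((∏ i, y (r i)) * f y) := by
    intro y
    have h2 : m (fun _ => y) = m (fun _ => ∑ i, y i • e i) := by rw [← hy y]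
    rw [h2, m.map_sum, Finset.sum_mul]
    refine Finset.sum_congr rfl fun r _ => ?_
    rw [m.map_smul_univ (fun i => y (r i)) (fun i => e (r i)), smul_eq_mul]
    ring
  have h3 : ∀ r : Fin n → Fin d, (fun y : Space d => (∏ i, y (r i)) * f y) =
      fun y : Space d => (∏ i, y i ^ (Finset.univ.filter fun k => r k = i).card) * f y := by
    intro r
    funext y
    rw [Finset.prod_comp (fun i => y i) r, Finset.prod_subset (Finset.subset_univ _)]
    intro i _ hi
    have : (Finset.univ.filter fun k => r k = i) = ∅ := by
      ext k
      simp only [Finset.mem_filter, Finset.mem_univ, true_and, Finset.notMem_empty, iff_false]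
      rintro rfl
      exact hi (Finset.mem_image_of_mem _ (Finset.mem_univ _))
    simp [this]
  simp_rw [h1]
  rw [integral_finsetSum]
  · refine Finset.sum_eq_zero fun r _ => ?_
    rw [integral_const_mul, h3 r, hf, mul_zero]
    rw [← Finset.card_eq_sum_card_fiberwise (t := Finset.univ) (fun _ _ => Finset.mem_univ _)]
    simpa using hn
  · intro r _
    refine Integrable.const_mul ?_ _
    let m' : ContinuousMultilinearMap ℝ (fun _ : Fin n => Space d) ℝ :=
      (ContinuousMultilinearMap.mkPiAlgebra ℝ (Fin n) ℝ).compContinuousLinearMap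
        (fun i => EuclideanSpace.proj (r i))
    simpa [m'] using integrable_multilinear_mul f m'

/-- Decay of the pairings of `f` with shifted and shrunk Schwartz functions. -/
theorem exists_integral_shrink_le {d : ℕ} {f : 𝓢(Space d, ℝ)} {N : ℕ}
    (hf : HasVanishingMoments f N) (M : ℕ) :
    ∃ C, 0 ≤ C ∧ ∀ (φ : 𝓢(Space d, ℝ)) (x : Space d) (c : ℝ), 0 ≤ c → c ≤ 1 →
      (1 + ‖x‖) ^ M * |∫ y, f y * φ (x + c • y)| ≤
        C * c ^ N * (Finset.Iic (M, N)).sup (schwartzSeminormFamily ℝ (Space d) ℝ) φ := by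
  have hint : Integrable fun y : Space d => (1 + ‖y‖) ^ M * ‖y‖ ^ N * ‖f y‖ := by
    have : ∀ y : Space d, (1 + ‖y‖) ^ M * ‖y‖ ^ N * ‖f y‖ =
        ∑ i ∈ Finset.range (M + 1), (M.choose i : ℝ) * (‖y‖ ^ (M - i + N) * ‖f y‖) := by
      intro y
      rw [add_pow, Finset.sum_mul, Finset.sum_mul]
      refine Finset.sum_congr rfl fun i _ => ?_
      rw [one_pow, pow_add]; ring
    simp_rw [this]
    exact integrable_finsetSum _ fun i _ => (f.integrable_pow_mul volume _).const_mul _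
  refine ⟨2 ^ M * ∫ y : Space d, (1 + ‖y‖) ^ M * ‖y‖ ^ N * ‖f y‖, by positivity, ?_⟩
  intro φ x c hc0 hc1
  set q := (Finset.Iic (M, N)).sup (schwartzSeminormFamily ℝ (Space d) ℝ) φ
  have hq : 0 ≤ q := apply_nonneg _ _
  -- Taylor polynomial of `y ↦ φ (x + c • y)` of degree below `N`. It integrates to zero against
  -- `f`, so subtracting it leaves a remainder of size `c ^ N`.
  let P : Space d → ℝ := fun y =>
    ∑ n ∈ Finset.range N, (n.factorial : ℝ)⁻¹ * iteratedFDeriv ℝ n φ x (fun _ => c • y)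
  have hterm : ∀ n, (fun y : Space d => f y *
      ((n.factorial : ℝ)⁻¹ * iteratedFDeriv ℝ n φ x (fun _ => c • y))) =
      fun y => ((n.factorial : ℝ)⁻¹ * c ^ n) * (iteratedFDeriv ℝ n φ x (fun _ => y) * f y) := by
    intro n
    funext y
    rw [(iteratedFDeriv ℝ n φ x).map_smul_univ (fun _ => c) (fun _ => y)]
    simp only [Finset.prod_const, Finset.card_univ, Fintype.card_fin, smul_eq_mul]
    ring
  have hPi : Integrable fun y => f y * P y := by
    simp only [P, Finset.mul_sum]
    refine integrable_finsetSum _ fun n _ => ?_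
    rw [hterm]
    exact (integrable_multilinear_mul f _).const_mul _
  have hP0 : ∫ y, f y * P y = 0 := by
    simp only [P, Finset.mul_sum]
    rw [integral_finsetSum]
    · refine Finset.sum_eq_zero fun n hn => ?_
      rw [hterm, integral_const_mul,
        integral_multilinear_mul_eq_zero hf (Finset.mem_range.1 hn), mul_zero]
    · intro n _
      rw [hterm]
      exact (integrable_multilinear_mul f _).const_mul _
  have hφi : Integrable fun y => f y * φ (x + c • y) := by
    refine (f.integrable (μ := volume)).mul_bdd (c := SchwartzMap.seminorm ℝ 0 0 φ) ?_
      (Eventually.of_forall fun y => φ.norm_le_seminorm ℝ _)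
    exact (φ.continuous.comp (by fun_prop)).aestronglyMeasurable
  have hpt : ∀ y : Space d, ‖(1 + ‖x‖) ^ M * (f y * φ (x + c • y) - f y * P y)‖ ≤
      2 ^ M * q * c ^ N * ((1 + ‖y‖) ^ M * ‖y‖ ^ N * ‖f y‖) := by
    intro y
    have h := taylor_remainder_le φ N M x (c • y)
    have hcy : ‖c • y‖ = c * ‖y‖ := by rw [norm_smul, Real.norm_of_nonneg hc0]
    have hle : 1 + ‖c • y‖ ≤ 1 + ‖y‖ := by
      rw [hcy]; gcongr; exact mul_le_of_le_one_left (norm_nonneg _) hc1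
    rw [← mul_sub, norm_mul, norm_mul, Real.norm_of_nonneg (by positivity)]
    calc _ = (1 + ‖x‖) ^ M * |φ (x + c • y) - P y| * ‖f y‖ := by rw [Real.norm_eq_abs (_ - _)]; ring
      _ ≤ 2 ^ M * q * ((1 + ‖c • y‖) ^ M * ‖c • y‖ ^ N) * ‖f y‖ := by gcongr
      _ ≤ 2 ^ M * q * ((1 + ‖y‖) ^ M * ‖c • y‖ ^ N) * ‖f y‖ := by gcongr
      _ = _ := by rw [hcy, mul_pow]; ring
  have hI : (1 + ‖x‖) ^ M * |∫ y, f y * φ (x + c • y)| =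
      ‖∫ y, (1 + ‖x‖) ^ M * (f y * φ (x + c • y) - f y * P y)‖ := by
    rw [integral_const_mul, integral_sub hφi hPi, hP0, sub_zero, norm_mul,
      Real.norm_of_nonneg (by positivity), Real.norm_eq_abs]
  rw [hI]
  refine (norm_integral_le_of_norm_le (hint.const_mul _) (Eventually.of_forall hpt)).trans
    (le_of_eq ?_)
  rw [integral_const_mul]
  ring

/-- A summable weight on the lattice `ℤ^d`. -/
def latticeWeight {d : ℕ} (k : Fin d → ℤ) : ℝ := ∏ i, ((1 + |(k i : ℝ)|) ^ 2)⁻¹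

theorem latticeWeight_nonneg {d : ℕ} (k : Fin d → ℤ) : 0 ≤ latticeWeight k :=
  Finset.prod_nonneg fun _ _ => by positivity

theorem summable_int_weight : Summable fun n : ℤ => ((1 + |(n : ℝ)|) ^ 2)⁻¹ := by
  have h : Summable fun n : ℕ => ((1 + (n : ℝ)) ^ 2)⁻¹ := by
    have := (summable_nat_add_iff 1).2 (Real.summable_nat_pow_inv.2 one_lt_two)
    simpa [add_comm] using this
  exact Summable.of_nat_of_neg (by simpa using h) (by simpa using h)

theorem summable_latticeWeight (d : ℕ) : Summable (latticeWeight : (Fin d → ℤ) → ℝ) := by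
  induction d with
  | zero => exact Summable.of_finite
  | succ d ih =>
    rw [← (Fin.consEquiv fun _ : Fin (d + 1) => ℤ).summable_iff]
    have h := summable_int_weight.mul_of_nonneg ih (fun _ => by positivity)
      latticeWeight_nonneg
    refine h.congr fun x => ?_
    simp [latticeWeight, Fin.prod_univ_succ, Fin.consEquiv, mul_comm]

theorem le_latticeWeight {d : ℕ} (k : Fin d → ℤ) :
    ((1 + ‖latticePoint k‖) ^ (2 * d))⁻¹ ≤ latticeWeight k := by
  rw [latticeWeight, Finset.prod_inv_distrib]
  refine inv_anti₀ (Finset.prod_pos fun i _ => by positivity) ?_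
  calc ∏ i, (1 + |(k i : ℝ)|) ^ 2 ≤ ∏ _i : Fin d, (1 + ‖latticePoint k‖) ^ 2 := by
        gcongr with i
        exact PiLp.norm_apply_le (latticePoint k) i
    _ = _ := by rw [Finset.prod_const, Finset.card_univ, Fintype.card_fin, pow_mul]

theorem integral_dilateTranslate_mul {d : ℕ} (f φ : 𝓢(Space d, ℝ)) (j : ℕ) (k : Fin d → ℤ) :
    ∫ x, dilateTranslate f j k x * φ x =
      (2 : ℝ) ^ ((j : ℝ) * (d : ℝ) / 2) * ((2 : ℝ) ^ (j * d))⁻¹ *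
        ∫ y, f y * φ (((2 : ℝ) ^ j)⁻¹ • latticePoint k + ((2 : ℝ) ^ j)⁻¹ • y) := by
  let G : Space d → ℝ := fun y =>
    f y * φ (((2 : ℝ) ^ j)⁻¹ • latticePoint k + ((2 : ℝ) ^ j)⁻¹ • y)
  have h1 : (fun x : Space d => dilateTranslate f j k x * φ x) = fun x =>
      (2 : ℝ) ^ ((j : ℝ) * (d : ℝ) / 2) * G ((2 : ℝ) ^ j • x - latticePoint k) := by
    funext x
    have : ((2 : ℝ) ^ j)⁻¹ • latticePoint k +
        ((2 : ℝ) ^ j)⁻¹ • ((2 : ℝ) ^ j • x - latticePoint k) = x := by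
      rw [smul_sub, smul_smul, inv_mul_cancel₀ (by positivity), one_smul, add_sub_cancel]
    simp only [G, this, dilateTranslate_apply, mul_assoc]
  have h2 := Measure.integral_comp_smul volume (fun z => G (z - latticePoint k)) ((2 : ℝ) ^ j)
  rw [integral_sub_right_eq_self (μ := volume) G, abs_of_pos (by positivity),
    finrank_euclideanSpace_fin, ← pow_mul, smul_eq_mul] at h2
  rw [h1, integral_const_mul, h2, mul_assoc]

/-- Decay of wavelet coefficients of Schwartz functions. -/
theorem exists_dilateTranslate_le {d : ℕ} {f : 𝓢(Space d, ℝ)} {N : ℕ}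
    (hf : HasVanishingMoments f N) :
    ∃ C, 0 ≤ C ∧ ∀ (φ : 𝓢(Space d, ℝ)) (j : ℕ) (k : Fin d → ℤ),
      (2 : ℝ) ^ (j * N) * |∫ x, dilateTranslate f j k x * φ x| ≤
        C * (2 : ℝ) ^ (j * (2 * d)) * latticeWeight k *
          (Finset.Iic (2 * d, N)).sup (schwartzSeminormFamily ℝ (Space d) ℝ) φ := by
  -- Decay of order `2 * d` in the position gives a square per coordinate, enough to sum over `ℤ^d`.
  obtain ⟨C, hC, h⟩ := exists_integral_shrink_le hf (2 * d)
  refine ⟨C, hC, fun φ j k => ?_⟩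
  set q := (Finset.Iic (2 * d, N)).sup (schwartzSeminormFamily ℝ (Space d) ℝ) φ
  have hq : 0 ≤ q := apply_nonneg _ _
  set c : ℝ := ((2 : ℝ) ^ j)⁻¹ with hc
  have hc0 : 0 < c := by positivity
  have hc1 : c ≤ 1 := inv_le_one_of_one_le₀ (one_le_pow₀ one_le_two)
  have h1 := h φ (c • latticePoint k) c hc0.le hc1
  rw [integral_dilateTranslate_mul, ← hc]
  set I := ∫ y, f y * φ (c • latticePoint k + c • y)
  have hfac : (2 : ℝ) ^ ((j : ℝ) * (d : ℝ) / 2) * ((2 : ℝ) ^ (j * d))⁻¹ ≤ 1 := by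
    rw [← div_eq_mul_inv, div_le_one (by positivity), ← Real.rpow_natCast]
    refine Real.rpow_le_rpow_of_exponent_le one_le_two ?_
    push_cast
    have : (0 : ℝ) ≤ (j : ℝ) * d := by positivity
    linarith
  -- Trades decay in the position `2^(-j) k` for decay in `k`, at the cost of the factor `2^(2dj)`.
  have hn : c * (1 + ‖latticePoint k‖) ≤ 1 + ‖c • latticePoint k‖ := by
    rw [norm_smul, Real.norm_of_nonneg hc0.le]
    nlinarith [norm_nonneg (latticePoint k)]
  have h2 : c ^ (2 * d) * (1 + ‖latticePoint k‖) ^ (2 * d) * |I| ≤ C * c ^ N * q := by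
    refine le_trans ?_ h1
    rw [← mul_pow]
    gcongr
  have h3 : |I| ≤ C * c ^ N * q * (c ^ (2 * d))⁻¹ * latticeWeight k := by
    calc |I| = (c ^ (2 * d) * (1 + ‖latticePoint k‖) ^ (2 * d) * |I|) * (c ^ (2 * d))⁻¹ *
          ((1 + ‖latticePoint k‖) ^ (2 * d))⁻¹ := by field_simp
      _ ≤ C * c ^ N * q * (c ^ (2 * d))⁻¹ * latticeWeight k := by
        gcongr
        exact le_latticeWeight k
  have hcN : ∀ n, c ^ n = ((2 : ℝ) ^ (j * n))⁻¹ := fun n => by rw [hc, inv_pow, pow_mul]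
  rw [hcN, hcN, inv_inv] at h3
  rw [abs_mul, abs_of_nonneg (by positivity)]
  calc _ ≤ (2 : ℝ) ^ (j * N) * (1 * |I|) := by gcongr
    _ ≤ (2 : ℝ) ^ (j * N) * (1 * (C * ((2 : ℝ) ^ (j * N))⁻¹ * q * 2 ^ (j * (2 * d)) *
        latticeWeight k)) := by gcongr
    _ = _ := by field_simp

/-! ### Convergence of wavelet series in `𝓢'`. -/

/-- The index set as a sum type. -/
def Index.equivSum (d : ℕ) :
    Index d ≃ (Fin d → ℤ) ⊕ (Fin (2 ^ d - 1) × ℕ × (Fin d → ℤ)) where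
  toFun
    | .scaling k => Sum.inl k
    | .wavelet e j k => Sum.inr (e, j, k)
  invFun
    | Sum.inl k => .scaling k
    | Sum.inr (e, j, k) => .wavelet e j k
  left_inv i := by cases i <;> rfl
  right_inv i := by rcases i with k | ⟨e, j, k⟩ <;> rfl

/-- Of the `A + 1 + 2 * d` moments used, `A` absorb the factor on the left, `2 * d` the loss from
lattice decay, and one leaves `2^(-j)` to sum over scales. The scaling function needs none, since it
occurs only at scale `0`. -/
theorem WaveletBasis.exists_summable_bound {d : ℕ} (W : WaveletBasis d) (A : ℕ) :
    ∃ b : Index d → ℝ, Summable b ∧ ∃ m : ℕ × ℕ, ∀ (φ : 𝓢(Space d, ℝ)) (i : Index d),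
      (2 : ℝ) ^ (A * i.scale) * |∫ x, W.psi i x * φ x| ≤
        b i * (Finset.Iic m).sup (schwartzSeminormFamily ℝ (Space d) ℝ) φ := by
  have hfather : HasVanishingMoments W.father 0 := fun n hn => absurd hn (Nat.not_lt_zero _)
  have hmother : ∀ e, HasVanishingMoments (W.mother e) (A + 1 + 2 * d) :=
    fun e n _ => W.moment_eq_zero e n
  obtain ⟨C₀, hC₀, h₀⟩ := exists_dilateTranslate_le hfather
  choose C hC h using fun e => exists_dilateTranslate_le (hmother e)
  let b : Index d → ℝ
    | .scaling k => C₀ * latticeWeight k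
    | .wavelet e j k => C e * (((1 / 2 : ℝ) ^ j) * latticeWeight k)
  refine ⟨b, ?_, (2 * d, A + 1 + 2 * d), fun φ i => ?_⟩
  · rw [← (Index.equivSum d).symm.summable_iff]
    have h0 : Summable fun k : Fin d → ℤ => b (.scaling k) :=
      (summable_latticeWeight d).mul_left C₀
    have h1 : Summable fun x : ℕ × (Fin d → ℤ) => (1 / 2 : ℝ) ^ x.1 * latticeWeight x.2 :=
      summable_geometric_two.mul_of_nonneg (summable_latticeWeight d)
        (fun _ => by positivity) latticeWeight_nonneg
    have h2 : Summable C := Summable.of_finite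
    have h3 : Summable fun x : Fin (2 ^ d - 1) × ℕ × (Fin d → ℤ) => b (.wavelet x.1 x.2.1 x.2.2) :=
      h2.mul_of_nonneg h1 hC
        (fun x => mul_nonneg (by positivity) (latticeWeight_nonneg _))
    exact Summable.sum _ h0 h3
  · cases i with
    | scaling k =>
      have h1 := h₀ φ 0 k
      simp only [zero_mul, pow_zero, mul_one, one_mul] at h1
      simp only [Index.scale, mul_zero, pow_zero, one_mul]
      refine h1.trans (mul_le_mul_of_nonneg_left ?_ (mul_nonneg hC₀ (latticeWeight_nonneg k)))
      exact Finset.sup_mono (f := schwartzSeminormFamily ℝ (Space d) ℝ)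
        (Finset.Iic_subset_Iic.2 (Prod.mk_le_mk.2 ⟨le_rfl, Nat.zero_le _⟩)) φ
    | wavelet e j k =>
      have h1 := h e φ j k
      set q := (Finset.Iic (2 * d, A + 1 + 2 * d)).sup
        (schwartzSeminormFamily ℝ (Space d) ℝ) φ
      change (2 : ℝ) ^ (A * j) * |∫ x, dilateTranslate (W.mother e) j k x * φ x| ≤
        C e * ((1 / 2 : ℝ) ^ j * latticeWeight k) * q
      set I := |∫ x, dilateTranslate (W.mother e) j k x * φ x|
      have hp : (0 : ℝ) < 2 ^ j * 2 ^ (j * (2 * d)) := by positivity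
      refine le_of_mul_le_mul_left ?_ hp
      have e1 : (2 : ℝ) ^ j * 2 ^ (j * (2 * d)) * (2 ^ (A * j) * I) =
          2 ^ (j * (A + 1 + 2 * d)) * I := by
        rw [show j * (A + 1 + 2 * d) = j + j * (2 * d) + A * j by ring, pow_add, pow_add]; ring
      have e2 : (2 : ℝ) ^ j * 2 ^ (j * (2 * d)) *
          (C e * ((1 / 2 : ℝ) ^ j * latticeWeight k) * q) =
          C e * 2 ^ (j * (2 * d)) * latticeWeight k * q := by
        rw [one_div, inv_pow]; field_simp
      rw [e1, e2]
      exact h1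

/-- Wavelet series with coefficients of polynomial growth in `2^|λ|` converge as distributions. -/
theorem WaveletBasis.exists_hasSum {d : ℕ} (W : WaveletBasis d) {ξ : Index d → ℝ} {B : ℝ} {A : ℕ}
    (hξ : ∀ i, |ξ i| ≤ B * (2 : ℝ) ^ (A * i.scale)) :
    ∃ g : Distr d, ∀ φ : 𝓢(Space d, ℝ), HasSum (fun i => ξ i * ∫ x, W.psi i x * φ x) (g φ) := by
  obtain ⟨b, hb, m, h⟩ := W.exists_summable_bound A
  have hB : 0 ≤ B := by
    have h0 := (abs_nonneg _).trans (hξ (.scaling 0))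
    simpa [Index.scale] using h0
  have hle : ∀ (φ : 𝓢(Space d, ℝ)) i, ‖ξ i * ∫ x, W.psi i x * φ x‖ ≤
      B * (b i * (Finset.Iic m).sup (schwartzSeminormFamily ℝ (Space d) ℝ) φ) := by
    intro φ i
    rw [norm_mul, Real.norm_eq_abs, Real.norm_eq_abs]
    calc _ ≤ B * (2 : ℝ) ^ (A * i.scale) * |∫ x, W.psi i x * φ x| := by gcongr; exact hξ i
      _ ≤ _ := by rw [mul_assoc]; exact mul_le_mul_of_nonneg_left (h φ i) hB
  have hsum : ∀ φ : 𝓢(Space d, ℝ), Summable fun i => ξ i * ∫ x, W.psi i x * φ x := fun φ =>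
    Summable.of_norm_bounded ((hb.mul_right _).mul_left B) (hle φ)
  have hint : ∀ i (φ : 𝓢(Space d, ℝ)), Integrable fun x => W.psi i x * φ x := fun i φ =>
    (φ.integrable (μ := volume)).bdd_mul (c := SchwartzMap.seminorm ℝ 0 0 (W.psi i))
      (W.psi i).continuous.aestronglyMeasurable
      (Eventually.of_forall fun y => (W.psi i).norm_le_seminorm ℝ _)
  refine ⟨SchwartzMap.mkCLMtoNormedSpace (σ := RingHom.id ℝ)
    (fun φ => ∑' i, ξ i * ∫ x, W.psi i x * φ x) ?_ ?_ ?_, fun φ => (hsum φ).hasSum⟩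
  · intro φ χ
    rw [← (hsum φ).tsum_add (hsum χ)]
    refine tsum_congr fun i => ?_
    rw [← mul_add, ← integral_add (hint i φ) (hint i χ)]
    simp [mul_add]
  · intro a φ
    rw [RingHom.id_apply, smul_eq_mul, ← tsum_mul_left]
    refine tsum_congr fun i => ?_
    rw [mul_left_comm a, ← integral_const_mul a]
    simp only [_root_.smul_apply, smul_eq_mul, mul_left_comm a]
  · refine ⟨Finset.Iic m, B * |∑' i, b i|, by positivity, fun φ => ?_⟩
    refine (tsum_of_norm_bounded (((hb.hasSum.mul_right _)).mul_left B) (hle φ)).trans ?_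
    rw [mul_assoc]
    gcongr
    exact le_abs_self _

theorem WaveletBasis.integral_psi_mul_psi {d : ℕ} [DecidableEq (Index d)] (W : WaveletBasis d)
    (i j : Index d) : ∫ x, W.psi i x * W.psi j x = if i = j then 1 else 0 := by
  rw [← orthonormal_iff_ite.1 W.orthonormal i j, L2.inner_def]
  refine integral_congr_ae ?_
  filter_upwards [(W.psi i).coeFn_toLp 2 volume, (W.psi j).coeFn_toLp 2 volume] with x hi hj
  have hi' : ((waveletFamily W.father W.mother i).toLp 2 volume : LTwo d) x = W.psi i x := hi
  have hj' : ((waveletFamily W.father W.mother j).toLp 2 volume : LTwo d) x = W.psi j x := hj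
  rw [hi', hj']
  simp [mul_comm]

/-! ### Besov spaces as sequence spaces, and the dual pairing. -/

theorem abs_rpow_le_of_hasSum {ι : Type*} {x : ι → ℝ} {p S : ℝ} (hp : 0 < p)
    (h : HasSum (fun i => |x i| ^ p) S) (i : ι) : |x i| ≤ S ^ (1 / p) := by
  rw [one_div, Real.le_rpow_inv_iff_of_pos (abs_nonneg _) (h.nonneg fun _ => by positivity) hp]
  exact le_hasSum h i fun _ _ => by positivity

theorem memℓp_ofReal_iff {ι : Type*} {x : ι → ℝ} {p : ℝ} (hp : 0 < p) :
    Memℓp x (ENNReal.ofReal p) ↔ Summable fun i => |x i| ^ p := by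
  rw [memℓp_gen_iff (by rwa [ENNReal.toReal_ofReal hp.le]), ENNReal.toReal_ofReal hp.le]
  rfl

theorem weight_pos {d : ℕ} (s p : ℝ) (i : Index d) : 0 < weight s p i := by
  unfold weight; positivity

/-- Every element of the sequence space `b^s_{p,p}` is the family of wavelet coefficients of an
element of `B^s_{p,p}`. -/
theorem WaveletBasis.exists_mem_besov {d : ℕ} (W : WaveletBasis d) {s p : ℝ} (hp : 0 < p)
    {ξ : Index d → ℝ} (hξ : Summable fun i => |weight s p i * ξ i| ^ p) :
    ∃ g ∈ Besov W s p, ∀ i, g (W.psi i) = ξ i := by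
  classical
  set t : ℝ := s + (d : ℝ) * (1 / 2 - 1 / p) with ht
  -- With this `A` the product `weight s p i * 2^(A|λ|)` is at least `1`, so the coefficients grow
  -- at most polynomially in `2^|λ|`.
  obtain ⟨A, hA⟩ := exists_nat_ge (-t)
  have hbound : ∀ i, |ξ i| ≤
      (∑' i, |weight s p i * ξ i| ^ p) ^ (1 / p) * (2 : ℝ) ^ (A * i.scale) := by
    intro i
    have h1 := abs_rpow_le_of_hasSum hp hξ.hasSum i
    have h2 : 1 ≤ weight s p i * (2 : ℝ) ^ (A * i.scale) := by
      rw [weight, ← ht, ← Real.rpow_natCast, ← Real.rpow_add two_pos]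
      refine Real.one_le_rpow one_le_two ?_
      push_cast
      rw [← add_mul]
      exact mul_nonneg (by linarith) (Nat.cast_nonneg _)
    calc |ξ i| ≤ |ξ i| * (weight s p i * (2 : ℝ) ^ (A * i.scale)) :=
          le_mul_of_one_le_right (abs_nonneg _) h2
      _ = |weight s p i * ξ i| * (2 : ℝ) ^ (A * i.scale) := by
        rw [abs_mul, abs_of_pos (weight_pos s p i)]; ring
      _ ≤ _ := by gcongr
  obtain ⟨g, hg⟩ := W.exists_hasSum hbound
  have hcoef : ∀ i, g (W.psi i) = ξ i := by
    intro i
    refine (hg (W.psi i)).unique ?_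
    have := hasSum_single (f := fun j => ξ j * ∫ x, W.psi j x * W.psi i x) i (fun j hj => by
      rw [W.integral_psi_mul_psi, if_neg hj, mul_zero])
    simpa only [W.integral_psi_mul_psi, if_true, mul_one] using this
  refine ⟨g, ⟨?_, fun φ => ?_⟩, hcoef⟩
  · rw [memℓp_ofReal_iff hp]
    simpa only [hcoef] using hξ
  · simpa only [hcoef] using hg φ

/-- The wavelets, viewed as distributions, belong to all Besov spaces. -/
theorem WaveletBasis.exists_psi_mem_besov {d : ℕ} [DecidableEq (Index d)] (W : WaveletBasis d)
    {s p : ℝ} (hp : 0 < p) (i : Index d) :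
    ∃ g ∈ Besov W s p, (∀ j, g (W.psi j) = if j = i then 1 else 0) ∧
      ∀ χ : 𝓢(Space d, ℝ), g χ = ∫ x, W.psi i x * χ x := by
  have hs : Summable fun j => |weight s p j * (if j = i then (1 : ℝ) else 0)| ^ p := by
    refine summable_of_ne_finset_zero (s := {i}) fun j hj => ?_
    rw [if_neg (by simpa using hj), mul_zero, abs_zero, Real.zero_rpow hp.ne']
  obtain ⟨g, hg, hc⟩ := W.exists_mem_besov hp hs
  refine ⟨g, hg, hc, fun χ => (hg.2 χ).unique ?_⟩
  have := hasSum_single (f := fun j => g (W.psi j) * ∫ x, W.psi j x * χ x) i (fun j hj => by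
    rw [hc, if_neg hj, zero_mul])
  simpa only [hc, if_true, one_mul] using this

theorem besovNorm_eq {d : ℕ} (W : WaveletBasis d) (s p : ℝ) (u : Distr d) :
    besovNorm W s p u = (∑' i, |weight s p i * u (W.psi i)| ^ p) ^ (1 / p) := by
  unfold besovNorm
  congr 1
  refine tsum_congr fun i => ?_
  rw [abs_mul, abs_of_pos (weight_pos s p i), Real.mul_rpow (weight_pos s p i).le (abs_nonneg _),
    weight, ← Real.rpow_mul two_pos.le]
  ring_nf

theorem summable_of_mem_besov {d : ℕ} {W : WaveletBasis d} {s p : ℝ} (hp : 0 < p) {u : Distr d}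
    (hu : u ∈ Besov W s p) : Summable fun i => |weight s p i * u (W.psi i)| ^ p :=
  (memℓp_ofReal_iff hp).1 hu.1

/-- True for every `f`: if `f` is not summable, neither is any of these tails, and `∑'` takes its
default value `0`. -/
theorem tendsto_tsum_ite_mem_atTop_zero {ι : Type*} [DecidableEq ι] (f : ι → ℝ) :
    Tendsto (fun S : Finset ι => ∑' i, if i ∈ S then 0 else f i) atTop (𝓝 0) := by
  refine (tendsto_tsum_compl_atTop_zero f).congr fun S => ?_
  have h : ∑' a : {x | x ∉ S}, f a = ∑' i, {x | x ∉ S}.indicator f i := tsum_subtype _ f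
  refine h.trans (tsum_congr fun i => ?_)
  by_cases hi : i ∈ S <;> simp [hi]

/-- The dual pairing of an element of the range of `F^*` is given by wavelet coefficients. -/
theorem hasSum_of_adjointRange {d : ℕ} {W : WaveletBasis d} {s p : ℝ} (hp : 0 < p)
    {F : Besov W s p →ₗ[ℝ] LTwo d} (hF : IsBoundedOp W F) {g : Distr d} {w : LTwo d}
    (hw : ∀ (φ : 𝓢(Space d, ℝ)) (u : Besov W s p),
      (∀ χ : 𝓢(Space d, ℝ), (u : Distr d) χ = ∫ x, φ x * χ x) → g φ = inner ℝ w (F u))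
    (h : Besov W s p) :
    HasSum (fun i => (h : Distr d) (W.psi i) * g (W.psi i)) (inner ℝ w (F h)) := by
  classical
  choose e he hec hei using fun i => W.exists_psi_mem_besov (s := s) hp i
  let E : Index d → Besov W s p := fun i => ⟨e i, he i⟩
  -- Truncated wavelet series. On them `hw` applies, being a statement about Schwartz functions
  -- only; they converge to `h` in norm, and continuity of `F` passes to the limit.
  let P : Finset (Index d) → Besov W s p := fun S => ∑ i ∈ S, (h : Distr d) (W.psi i) • E i
  have hP : ∀ S, inner ℝ w (F (P S)) = ∑ i ∈ S, (h : Distr d) (W.psi i) * g (W.psi i) := by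
    intro S
    simp only [P, map_sum, map_smul, inner_sum, inner_smul_right]
    exact Finset.sum_congr rfl fun i _ => by rw [hw (W.psi i) (E i) (hei i)]
  have hcoef : ∀ S i, ((h - P S : Besov W s p) : Distr d) (W.psi i) =
      if i ∈ S then 0 else (h : Distr d) (W.psi i) := by
    intro S i
    have h1 : ((P S : Besov W s p) : Distr d) (W.psi i) =
        if i ∈ S then (h : Distr d) (W.psi i) else 0 := by
      simp only [P, Submodule.coe_sum, Submodule.coe_smul, E]
      rw [_root_.sum_apply]
      simp [hec]
    rw [Submodule.coe_sub, _root_.sub_apply, h1]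
    split_ifs <;> simp
  have hnorm : Tendsto (fun S => besovNorm W s p ((h - P S : Besov W s p) : Distr d)) atTop
      (𝓝 0) := by
    have h2 := (tendsto_tsum_ite_mem_atTop_zero
      (fun i => |weight s p i * (h : Distr d) (W.psi i)| ^ p)).rpow_const (p := 1 / p)
        (Or.inr (by positivity))
    rw [Real.zero_rpow (by positivity)] at h2
    refine h2.congr fun S => ?_
    rw [besovNorm_eq]
    congr 1
    refine tsum_congr fun i => ?_
    rw [hcoef]
    by_cases hi : i ∈ S
    · rw [if_pos hi, if_pos hi, mul_zero, abs_zero, Real.zero_rpow hp.ne']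
    · rw [if_neg hi, if_neg hi]
  obtain ⟨M, hM⟩ := hF
  have hconv : Tendsto (fun S => F (P S)) atTop (𝓝 (F h)) := by
    rw [tendsto_iff_norm_sub_tendsto_zero]
    have hlim := hnorm.const_mul M
    rw [mul_zero] at hlim
    refine squeeze_zero (fun _ => norm_nonneg _) (fun S => ?_) hlim
    have h1 : F h = F (h - P S) + F (P S) :=
      (congrArg F (sub_add_cancel h (P S)).symm).trans (F.map_add _ _)
    rw [norm_sub_rev, h1, add_sub_cancel_right]
    exact hM (h - P S)
  have h3 : Tendsto (fun S => inner ℝ w (F (P S))) atTop (𝓝 (inner ℝ w (F h))) :=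
    (tendsto_const_nhds (x := w)).inner hconv
  simp only [hP] at h3
  exact h3

/-! ### Bregman distance of `|·|^p` for `1 < p ≤ 2`. -/

theorem abs_rpow_sub_two_mul_abs {p : ℝ} (hp : 1 < p) (x : ℝ) :
    |x| ^ (p - 2) * |x| = |x| ^ (p - 1) := by
  rcases eq_or_ne x 0 with rfl | hx
  · simp [Real.zero_rpow (sub_pos.2 hp).ne']
  · rw [← Real.rpow_add_one (abs_ne_zero.2 hx)]
    ring_nf

theorem abs_rpow_sub_two_mul_mul_self {p : ℝ} (hp : 1 < p) (x : ℝ) :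
    |x| ^ (p - 2) * x * x = |x| ^ p := by
  rcases eq_or_ne x 0 with rfl | hx
  · simp [Real.zero_rpow (zero_lt_one.trans hp).ne']
  · rw [mul_assoc, ← abs_mul_abs_self x, ← mul_assoc, ← Real.rpow_add_one (abs_ne_zero.2 hx),
      ← Real.rpow_add_one (abs_ne_zero.2 hx)]
    ring_nf

/-- The derivative is `(p - 1) (x^(p-2) - M^(p-2))`, nonnegative on `(0, M)` because `p - 2 ≤ 0`. -/
theorem monotoneOn_rpow_sub {p M : ℝ} (hp : 1 < p) (hp2 : p ≤ 2) :
    MonotoneOn (fun x : ℝ => x ^ (p - 1) - (p - 1) * M ^ (p - 2) * x) (Set.Icc 0 M) := by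
  refine monotoneOn_of_hasDerivWithinAt_nonneg (convex_Icc 0 M)
    (f' := fun x => (p - 1) * x ^ (p - 1 - 1) - (p - 1) * M ^ (p - 2)) ?_ ?_ ?_
  · exact ((Real.continuous_rpow_const (by linarith)).sub (by fun_prop)).continuousOn
  · intro x hx
    rw [interior_Icc] at hx
    have h := (Real.hasDerivAt_rpow_const (p := p - 1) (Or.inl hx.1.ne')).sub
      ((hasDerivAt_id x).const_mul ((p - 1) * M ^ (p - 2)))
    rw [mul_one] at h
    exact h.hasDerivWithinAt
  · intro x hx
    rw [interior_Icc] at hx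
    rw [← mul_sub, show p - 1 - 1 = p - 2 by ring]
    exact mul_nonneg (by linarith)
      (sub_nonneg.2 (Real.rpow_le_rpow_of_nonpos hx.1 hx.2.le (by linarith)))

/-- Strong monotonicity on `[-M, M]` of `|x|^(p-2) x`, the derivative of `|x|^p / p`. Oddness
reduces it to nonnegative arguments; opposite signs are split at `0`. -/
theorem rpow_sub_two_mul_sub_le {p M x y : ℝ} (hp : 1 < p) (hp2 : p ≤ 2) (hx : |x| ≤ M)
    (hy : |y| ≤ M) (hxy : x ≤ y) :
    (p - 1) * M ^ (p - 2) * (y - x) ≤ |y| ^ (p - 2) * y - |x| ^ (p - 2) * x := by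
  have hmono := monotoneOn_rpow_sub (M := M) hp hp2
  have hM : 0 ≤ M := (abs_nonneg x).trans hx
  have hpos : ∀ {x y : ℝ}, 0 ≤ x → x ≤ y → y ≤ M →
      (p - 1) * M ^ (p - 2) * (y - x) ≤ |y| ^ (p - 2) * y - |x| ^ (p - 2) * x := by
    intro x y hx hxy hy
    have h := hmono ⟨hx, hxy.trans hy⟩ ⟨hx.trans hxy, hy⟩ hxy
    have h1 := abs_rpow_sub_two_mul_abs hp x
    have h2 := abs_rpow_sub_two_mul_abs hp y
    rw [abs_of_nonneg hx] at h1
    rw [abs_of_nonneg (hx.trans hxy)] at h2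
    rw [abs_of_nonneg hx, abs_of_nonneg (hx.trans hxy), h1, h2]
    dsimp only at h
    linarith
  rcases le_total 0 x with h0 | h0
  · exact hpos h0 hxy ((le_abs_self y).trans hy)
  · have hx' : -x ≤ M := (neg_le_abs x).trans hx
    rcases le_total 0 y with h1 | h1
    · have e1 := hpos le_rfl h1 ((le_abs_self y).trans hy)
      have e2 := hpos le_rfl (neg_nonneg.2 h0) hx'
      simp only [abs_neg, mul_zero, sub_zero] at e1 e2
      linarith
    · have e := hpos (neg_nonneg.2 h1) (neg_le_neg hxy) hx'
      simp only [abs_neg] at e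
      linarith

/-- Lower bound for the Bregman distance of `|·|^p`, `1 < p ≤ 2`, on bounded sets. -/
theorem le_bregman_abs_rpow {p M x a : ℝ} (hp : 1 < p) (hp2 : p ≤ 2) (hx : |x| ≤ M)
    (ha : |a| ≤ M) :
    p * (p - 1) / 2 * M ^ (p - 2) * (x - a) ^ 2 ≤
      |x| ^ p - |a| ^ p - p * (|a| ^ (p - 2) * a) * (x - a) := by
  set κ := (p - 1) * M ^ (p - 2) with hκ
  -- The Bregman distance minus the claimed quadratic, up to the constant `|a|^p`. By strong
  -- monotonicity its derivative is nonpositive left of `a` and nonnegative right of it within `[-M,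
  -- M]`, so `a` is a minimum there.
  let f : ℝ → ℝ := fun t =>
    |t| ^ p - p * (|a| ^ (p - 2) * a) * (t - a) - p * κ / 2 * (t - a) ^ 2
  have hf : ∀ t, HasDerivAt f
      (p * (|t| ^ (p - 2) * t - |a| ^ (p - 2) * a - κ * (t - a))) t := by
    intro t
    have h1 := hasDerivAt_abs_rpow t hp
    have h2 := ((hasDerivAt_id t).sub_const a).const_mul (p * (|a| ^ (p - 2) * a))
    have h3 := (((hasDerivAt_id t).sub_const a).pow 2).const_mul (p * κ / 2)
    refine ((h1.sub h2).sub h3).congr_deriv ?_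
    simp
    ring
  have hcont : Continuous f := continuous_iff_continuousAt.2 fun t => (hf t).continuousAt
  have hfa : f a = |a| ^ p := by simp [f]
  have hp0 : 0 < p := by linarith
  suffices h : f a ≤ f x by
    rw [hfa] at h
    have e : p * (p - 1) / 2 * M ^ (p - 2) = p * κ / 2 := by rw [hκ]; ring
    rw [e]
    dsimp only [f] at h
    linarith
  rcases lt_trichotomy x a with hxa | rfl | hxa
  · obtain ⟨t, ht, e⟩ := exists_hasDerivAt_eq_slope f _ hxa hcont.continuousOn fun t _ => hf t
    have htM : |t| ≤ M := abs_le.2 ⟨(abs_le.1 hx).1.trans ht.1.le, ht.2.le.trans (abs_le.1 ha).2⟩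
    have h := rpow_sub_two_mul_sub_le hp hp2 htM ha ht.2.le
    rw [eq_div_iff (sub_pos.2 hxa).ne'] at e
    have h1 : |t| ^ (p - 2) * t - |a| ^ (p - 2) * a - κ * (t - a) ≤ 0 := by linarith
    have h2 := mul_nonpos_of_nonpos_of_nonneg
      (mul_nonpos_of_nonneg_of_nonpos hp0.le h1) (sub_pos.2 hxa).le
    linarith
  · exact le_rfl
  · obtain ⟨t, ht, e⟩ := exists_hasDerivAt_eq_slope f _ hxa hcont.continuousOn fun t _ => hf t
    have htM : |t| ≤ M := abs_le.2 ⟨(abs_le.1 ha).1.trans ht.1.le, ht.2.le.trans (abs_le.1 hx).2⟩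
    have h := rpow_sub_two_mul_sub_le hp hp2 ha htM ht.1.le
    rw [eq_div_iff (sub_pos.2 hxa).ne'] at e
    have h1 : 0 ≤ |t| ^ (p - 2) * t - |a| ^ (p - 2) * a - κ * (t - a) := by linarith
    have h2 := mul_nonneg (mul_nonneg hp0.le h1) (sub_pos.2 hxa).le
    linarith

/-- Lower bound for the Bregman distance of the `p`-th power of the `ℓ^p` norm, `1 < p ≤ 2`. -/
theorem summable_sq_sub_of_bregman {ι : Type*} {p R L SX SA : ℝ} {X A : ι → ℝ} (hp : 1 < p)
    (hp2 : p ≤ 2) (hX : HasSum (fun i => |X i| ^ p) SX) (hA : HasSum (fun i => |A i| ^ p) SA)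
    (hXR : SX ≤ R) (hAR : SA ≤ R) (hR : 0 < R)
    (hL : HasSum (fun i => p * (|A i| ^ (p - 2) * A i) * (X i - A i)) L) :
    Summable (fun i => (X i - A i) ^ 2) ∧
      p * (p - 1) / 2 * (R ^ (1 / p)) ^ (p - 2) * ∑' i, (X i - A i) ^ 2 ≤ SX - SA - L := by
  have hp0 : 0 < p := by linarith
  set κ := p * (p - 1) / 2 * (R ^ (1 / p)) ^ (p - 2) with hκ
  have hκ0 : 0 < κ := by
    have : 0 < p - 1 := by linarith
    positivity
  -- A bound on the `ℓ^p` norm bounds every entry, so the scalar inequality holds with one `M =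
  -- R^(1/p)`, hence one `κ`, for all indices.
  have hbound : ∀ {Y : ι → ℝ} {S : ℝ}, HasSum (fun i => |Y i| ^ p) S → S ≤ R →
      ∀ i, |Y i| ≤ R ^ (1 / p) := fun hY hS i =>
    (abs_rpow_le_of_hasSum hp0 hY i).trans
      (Real.rpow_le_rpow (hY.nonneg fun _ => by positivity) hS (by positivity))
  have hB := (hX.sub hA).sub hL
  have hle : ∀ i, κ * (X i - A i) ^ 2 ≤
      |X i| ^ p - |A i| ^ p - p * (|A i| ^ (p - 2) * A i) * (X i - A i) := fun i =>
    le_bregman_abs_rpow hp hp2 (hbound hX hXR i) (hbound hA hAR i)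
  have hs : Summable fun i => κ * (X i - A i) ^ 2 :=
    Summable.of_nonneg_of_le (fun i => by positivity) hle hB.summable
  refine ⟨(summable_mul_left_iff hκ0.ne').1 hs, ?_⟩
  rw [← tsum_mul_left, ← hB.tsum_eq]
  exact hs.tsum_le_tsum hle hB.summable

/-! ### Tikhonov functional and source condition. -/

theorem tikhonov_of_mem {d : ℕ} {W : WaveletBasis d} {sD pD : ℝ} {F : Besov W sD pD →ₗ[ℝ] LTwo d}
    {sR pR α : ℝ} {vδ : LTwo d} {u : Besov W sD pD} (hp : 0 < pR) (hα : 0 ≤ α)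
    (hu : (u : Distr d) ∈ Besov W sR pR) :
    tikhonov W F sR pR α vδ u = ENNReal.ofReal (‖F u - vδ‖ ^ 2 +
      α * ∑' i, |weight sR pR i * (u : Distr d) (W.psi i)| ^ pR) := by
  have h0 : 0 ≤ ∑' i, |weight sR pR i * (u : Distr d) (W.psi i)| ^ pR :=
    tsum_nonneg fun _ => by positivity
  rw [tikhonov, besovENorm, if_pos hu, besovNorm_eq,
    ENNReal.ofReal_rpow_of_nonneg (by positivity) hp.le, ← Real.rpow_mul h0, one_div_mul_cancel hp.ne',
    Real.rpow_one, ← ENNReal.ofReal_mul hα, ← ENNReal.ofReal_add (by positivity) (by positivity)]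

/-- Strict positivity of `α` matters: `0 * ⊤ = 0` in `ℝ≥0∞`. -/
theorem tikhonov_of_notMem {d : ℕ} {W : WaveletBasis d} {sD pD : ℝ}
    {F : Besov W sD pD →ₗ[ℝ] LTwo d} {sR pR α : ℝ} {vδ : LTwo d} {u : Besov W sD pD}
    (hp : 0 < pR) (hα : 0 < α) (hu : (u : Distr d) ∉ Besov W sR pR) :
    tikhonov W F sR pR α vδ u = ⊤ := by
  rw [tikhonov, besovENorm, if_neg hu, ENNReal.top_rpow_of_pos hp,
    ENNReal.mul_top (by simpa using hα), add_top]

/-- A minimizer of the Tikhonov functional belongs to `B_R` if a competitor does. -/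
theorem tikhonov_minimizer {d : ℕ} {W : WaveletBasis d} {sD pD : ℝ}
    {F : Besov W sD pD →ₗ[ℝ] LTwo d} {sR pR α : ℝ} {vδ : LTwo d} {u u' : Besov W sD pD}
    (hp : 0 < pR) (hα : 0 < α) (hu' : (u' : Distr d) ∈ Besov W sR pR)
    (h : tikhonov W F sR pR α vδ u ≤ tikhonov W F sR pR α vδ u') :
    (u : Distr d) ∈ Besov W sR pR ∧
      ‖F u - vδ‖ ^ 2 + α * ∑' i, |weight sR pR i * (u : Distr d) (W.psi i)| ^ pR ≤
        ‖F u' - vδ‖ ^ 2 + α * ∑' i, |weight sR pR i * (u' : Distr d) (W.psi i)| ^ pR := by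
  rw [tikhonov_of_mem hp hα.le hu'] at h
  by_cases hu : (u : Distr d) ∈ Besov W sR pR
  · refine ⟨hu, ?_⟩
    rw [tikhonov_of_mem hp hα.le hu] at h
    refine (ENNReal.ofReal_le_ofReal_iff ?_).1 h
    have : 0 ≤ ∑' i, |weight sR pR i * (u' : Distr d) (W.psi i)| ^ pR :=
      tsum_nonneg fun _ => by positivity
    positivity
  · rw [tikhonov_of_notMem hp hα hu, top_le_iff] at h
    exact absurd h ENNReal.ofReal_ne_top

/-- The real inequality behind the convergence rate. -/
theorem bregman_rate {c C δ α r ω D : ℝ} (hc : 0 < c) (hδ : 0 < δ) (hα : c * δ ≤ α)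
    (hα' : α ≤ C * δ) (h : r ^ 2 + α * D ≤ δ ^ 2 + α * (ω * (r + δ))) :
    D ≤ (1 / c + ω + C * ω ^ 2 / 4) * δ := by
  have hα0 : 0 < α := (mul_pos hc hδ).trans_le hα
  -- Young: `αωr ≤ r² + α²ω²/4`, which cancels the residual. Dividing by `α`, the lower bound on `α`
  -- handles `δ²` and the upper bound handles the last term.
  have h1 : α * D ≤ δ ^ 2 + α * ω * δ + α ^ 2 * ω ^ 2 / 4 := by
    nlinarith [sq_nonneg (r - α * ω / 2)]
  have h2 : δ ^ 2 ≤ α * (1 / c * δ) := by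
    calc δ ^ 2 = c * δ * (1 / c * δ) := by field_simp
      _ ≤ _ := by gcongr
  have h3 : α ^ 2 * ω ^ 2 / 4 ≤ α * (C * ω ^ 2 / 4 * δ) := by
    calc α ^ 2 * ω ^ 2 / 4 = α * (α * (ω ^ 2 / 4)) := by ring
      _ ≤ α * (C * δ * (ω ^ 2 / 4)) := by gcongr
      _ = _ := by ring
  refine le_of_mul_le_mul_left ?_ hα0
  calc α * D ≤ _ := h1
    _ ≤ α * (1 / c * δ) + α * ω * δ + α * (C * ω ^ 2 / 4 * δ) := by gcongr
    _ = _ := by ring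

/-- The coefficients of a subgradient of `‖·‖_{B_R}^{p_R}` at an element of `B_S` lie in `b_G`. -/
theorem summable_subgradient {d : ℕ} {sS pS sG pG sR pR : ℝ} (hpS : 0 < pS) (hpG : 0 < pG)
    (hpR : pR = (pS + pG) / pG) (hsR : sR ≤ (pS * sS - pG * sG) / (pS + pG))
    {a : Index d → ℝ} (ha : Summable fun i => |weight sS pS i * a i| ^ pS) :
    Summable fun i => |weight sG pG i *
      (pR * (|weight sR pR i * a i| ^ (pR - 2) * (weight sR pR i * a i)) * weight sR pR i)| ^ pG := by
  have hp1 : pR - 1 = pS / pG := by rw [hpR]; field_simp; ring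
  have hp : 1 < pR := by
    have : 0 < pS / pG := by positivity
    linarith
  have hp0 : 0 < pR := by linarith
  refine Summable.of_nonneg_of_le (fun i => by positivity) (fun i => ?_) (ha.mul_left (pR ^ pG))
  have hw := weight_pos sR pR i
  have hw' := weight_pos sG pG i
  have hw'' := weight_pos sS pS i
  have e1 : |weight sG pG i * (pR * (|weight sR pR i * a i| ^ (pR - 2) *
      (weight sR pR i * a i)) * weight sR pR i)| =
      pR * (weight sG pG i * weight sR pR i * (weight sR pR i * |a i|) ^ (pS / pG)) := by
    rw [← hp1]
    have h := abs_rpow_sub_two_mul_abs hp (weight sR pR i * a i)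
    rw [abs_mul, abs_mul, abs_mul, abs_mul (|_| ^ _), abs_of_pos hp0, abs_of_pos hw',
      abs_of_nonneg (Real.rpow_nonneg (abs_nonneg _) _), h, abs_of_pos hw, abs_mul, abs_of_pos hw]
    ring
  rw [e1, Real.mul_rpow hp0.le (by positivity)]
  refine mul_le_mul_of_nonneg_left ?_ (by positivity)
  rw [Real.mul_rpow (by positivity) (by positivity), ← Real.rpow_mul (by positivity),
    div_mul_cancel₀ _ hpG.ne', Real.mul_rpow hw'.le hw.le, Real.mul_rpow hw.le (abs_nonneg _),
    abs_mul, abs_of_pos hw'', Real.mul_rpow hw''.le (abs_nonneg _), ← mul_assoc]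
  refine mul_le_mul_of_nonneg_right ?_ (by positivity)
  unfold weight
  simp only [← Real.rpow_mul two_pos.le]
  rw [← Real.rpow_add two_pos, ← Real.rpow_add two_pos]
  refine Real.rpow_le_rpow_of_exponent_le one_le_two ?_
  have hsum : (pS + pG) * sR ≤ pS * sS - pG * sG := by
    rw [le_div_iff₀ (by positivity)] at hsR
    linarith
  have h1 : (pG + pS) * (1 / pR) = pG := by rw [hpR]; field_simp; ring
  have h2 : pG * (1 / pG) = 1 := by field_simp
  have h3 : pS * (1 / pS) = 1 := by field_simp
  -- Comparison of the exponents of `2^|λ|`. The dimensional terms agree on both sides, each being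
  -- `d (p_S / 2 - 1)`; what remains is the condition on `s_R`.
  have h4 : pG * (sG + d * (1 / 2 - 1 / pG)) + (pG + pS) * (sR + d * (1 / 2 - 1 / pR)) ≤
      pS * (sS + d * (1 / 2 - 1 / pS)) := by
    have e2 : pG * (sG + d * (1 / 2 - 1 / pG)) + (pG + pS) * (sR + d * (1 / 2 - 1 / pR)) =
        pG * sG + (pS + pG) * sR + d * (pG / 2 - pG * (1 / pG) + (pG + pS) / 2 -
          (pG + pS) * (1 / pR)) := by ring
    have e3 : pS * (sS + d * (1 / 2 - 1 / pS)) =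
        pS * sS + d * (pS / 2 - pS * (1 / pS)) := by ring
    rw [e2, e3, h1, h2, h3]
    have : (d : ℝ) * (pG / 2 - 1 + (pG + pS) / 2 - pG) = d * (pS / 2 - 1) := by ring
    rw [this]
    linarith
  have h5 := mul_le_mul_of_nonneg_right h4 (Nat.cast_nonneg (α := ℝ) i.scale)
  linarith

end BesovTikhonov

end

open BesovTikhonov

/-! ### The convergence rate. -/

theorem mainTheorem2 {d : ℕ} (W : BesovTikhonov.WaveletBasis d)
    (sD pD sS pS sG pG sR pR σ : ℝ)
    (hpD : 1 < pD) (hpS : 0 < pS) (hpG : 0 < pG) (hpSG : pS ≤ pG)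
    (F : BesovTikhonov.Besov W sD pD →ₗ[ℝ] BesovTikhonov.LTwo d)
    (hF : BesovTikhonov.IsBoundedOp W F)
    (hG : (BesovTikhonov.Besov W sG pG : Set (BesovTikhonov.Distr d)) ⊆
      BesovTikhonov.adjointRange W F)
    (hSD : BesovTikhonov.Besov W sS pS ≤ BesovTikhonov.Besov W sD pD)
    (udag : BesovTikhonov.Besov W sD pD)
    (hudag : (udag : BesovTikhonov.Distr d) ∈ BesovTikhonov.Besov W sS pS)
    (v : BesovTikhonov.LTwo d) (hv : F udag = v)
    (hpR : pR = (pS + pG) / pG)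
    (hsR : sR ≤ (pS * sS - pG * sG) / (pS + pG))
    (hσ : σ = sR + (d : ℝ) * (1 / 2 - 1 / pR))
    (c C : ℝ) (hc : 0 < c) (hC : 0 < C) :
    ∃ K > 0, ∃ δ₀ > 0, ∀ δ : ℝ, 0 < δ → δ ≤ δ₀ →
      ∀ α : ℝ, c * δ ≤ α → α ≤ C * δ →
      ∀ vδ : BesovTikhonov.LTwo d, ‖v - vδ‖ ≤ δ →
      ∀ u : BesovTikhonov.Besov W sD pD,
        (∀ u' : BesovTikhonov.Besov W sD pD,
          BesovTikhonov.tikhonov W F sR pR α vδ u ≤ BesovTikhonov.tikhonov W F sR pR α vδ u') →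
        (u : BesovTikhonov.Distr d) - (udag : BesovTikhonov.Distr d) ∈ BesovTikhonov.Besov W σ 2 ∧
        BesovTikhonov.besovNorm W σ 2
          ((u : BesovTikhonov.Distr d) - (udag : BesovTikhonov.Distr d)) ≤ K * √δ := by
  have hp1 : pR - 1 = pS / pG := by rw [hpR]; field_simp; ring
  have hp : 1 < pR := by
    have : 0 < pS / pG := by positivity
    linarith
  have hp2 : pR ≤ 2 := by
    have : pS / pG ≤ 1 := (div_le_one hpG).2 hpSG
    linarith
  have hp0 : 0 < pR := by linarith
  have hpD0 : 0 < pD := by linarith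
  set A : Index d → ℝ := fun i => weight sR pR i * (udag : Distr d) (W.psi i) with hA
  -- `g` is the subgradient of the penalty at `u†`, and `w` its source element.
  obtain ⟨g, hgG, hg⟩ := W.exists_mem_besov hpG
    (summable_subgradient hpS hpG hpR hsR (summable_of_mem_besov hpS hudag))
  obtain ⟨w, hw⟩ := hG hgG
  have hpair := hasSum_of_adjointRange hpD0 hF hw
  -- The terms of the pairing of `g` with `u†` are `p_R |A_λ|^p_R`; its convergence therefore puts
  -- `u†` in `B_R`.
  have hAs : Summable fun i => |A i| ^ pR := by
    refine (summable_mul_left_iff hp0.ne').1 ((hpair udag).summable.congr fun i => ?_)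
    rw [hg, ← abs_rpow_sub_two_mul_mul_self hp]
    simp only [hA]
    ring
  have hudagR : (udag : Distr d) ∈ Besov W sR pR := ⟨(memℓp_ofReal_iff hp0).2 hAs, udag.2.2⟩
  set S₀ := ∑' i, |A i| ^ pR with hS₀
  have hS₀0 : 0 ≤ S₀ := tsum_nonneg fun _ => by positivity
  -- Common bound for both penalties: minimality gives `S ≤ S₀ + δ²/α`, and `δ²/α ≤ δ/c ≤ 1/c` once
  -- `δ ≤ 1`, whence `δ₀ = 1`.
  set R := S₀ + 1 / c with hR
  have hc' : 0 < 1 / c := by positivity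
  have hR0 : 0 < R := by positivity
  set κ := pR * (pR - 1) / 2 * (R ^ (1 / pR)) ^ (pR - 2) with hκ
  have hκ0 : 0 < κ := by
    have : 0 < pR - 1 := by linarith
    positivity
  set K₀ := 1 / c + ‖w‖ + C * ‖w‖ ^ 2 / 4 with hK₀
  have hK₀0 : 0 < K₀ := by positivity
  refine ⟨√(K₀ / κ), Real.sqrt_pos.2 (by positivity), 1, one_pos, ?_⟩
  intro δ hδ hδ1 α hcα hαC vδ hvδ u hmin
  have hα0 : 0 < α := (mul_pos hc hδ).trans_le hcα
  obtain ⟨huR, hT⟩ := tikhonov_minimizer hp0 hα0 hudagR (hmin udag)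
  set X : Index d → ℝ := fun i => weight sR pR i * (u : Distr d) (W.psi i) with hX
  have hXs : Summable fun i => |X i| ^ pR := summable_of_mem_besov hp0 huR
  set S := ∑' i, |X i| ^ pR with hS
  rw [hv] at hT
  have hvδ2 : ‖v - vδ‖ ^ 2 ≤ δ ^ 2 := by gcongr
  have hT' : ‖F u - vδ‖ ^ 2 + α * S ≤ δ ^ 2 + α * S₀ := hT.trans (by gcongr)
  have hSR : S ≤ R := by
    refine le_of_mul_le_mul_left ?_ hα0
    have h1 : δ ^ 2 ≤ α * (1 / c) := by
      calc δ ^ 2 = c * δ * (1 / c) * δ := by field_simp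
        _ ≤ α * (1 / c) * 1 := by gcongr
        _ = _ := mul_one _
    rw [hR, mul_add]
    nlinarith [sq_nonneg ‖F u - vδ‖]
  -- The source condition turns the linear term of the Bregman distance into `⟨w, Fu - v⟩`,
  -- controlled by the residual.
  have hL : HasSum (fun i => pR * (|A i| ^ (pR - 2) * A i) * (X i - A i))
      (inner ℝ w (F u) - inner ℝ w v) := by
    rw [← hv]
    refine ((hpair u).sub (hpair udag)).congr_fun fun i => ?_
    rw [hg]
    simp only [hA, hX]
    ring
  obtain ⟨hsq, hle⟩ := summable_sq_sub_of_bregman hp hp2 hXs.hasSum hAs.hasSum hSR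
    (by rw [hR]; linarith) hR0 hL
  have hLabs : -(inner ℝ w (F u) - inner ℝ w v) ≤ ‖w‖ * (‖F u - vδ‖ + δ) := by
    rw [← inner_sub_right]
    calc -(inner ℝ w (F u - v)) ≤ ‖w‖ * ‖F u - v‖ :=
          (neg_le_abs _).trans (abs_real_inner_le_norm _ _)
      _ ≤ _ := by
        gcongr
        calc ‖F u - v‖ = ‖(F u - vδ) - (v - vδ)‖ := by rw [sub_sub_sub_cancel_right]
          _ ≤ ‖F u - vδ‖ + ‖v - vδ‖ := norm_sub_le _ _
          _ ≤ _ := by gcongr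
  have hrate : S - S₀ - (inner ℝ w (F u) - inner ℝ w v) ≤ K₀ * δ := by
    refine bregman_rate hc hδ hcα hαC (r := ‖F u - vδ‖) ?_
    have h1 := mul_le_mul_of_nonneg_left hLabs hα0.le
    rw [mul_sub, mul_sub]
    linarith
  -- For `p = 2` the dimensional correction vanishes, so the `H^σ` norm of `u - u†` is the `ℓ²` norm
  -- of `X - A`.
  have hweight : ∀ i : Index d, weight σ 2 i = weight sR pR i := fun i => by
    simp [weight, hσ]
  have hcoef : ∀ i, weight σ 2 i * ((u : Distr d) - (udag : Distr d)) (W.psi i) = X i - A i :=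
    fun i => by
      rw [hweight, _root_.sub_apply, mul_sub]
  have hcoef2 : ∀ i, |weight σ 2 i * ((u : Distr d) - (udag : Distr d)) (W.psi i)| ^ (2 : ℝ) =
      (X i - A i) ^ 2 := fun i => by
    rw [hcoef, Real.rpow_two, sq_abs]
  -- Convergence of the wavelet series of `u - u†` does not involve the norm, so it is inherited
  -- from `B_D`.
  refine ⟨⟨(memℓp_ofReal_iff two_pos).2 ?_, ((u - udag : Besov W sD pD)).2.2⟩, ?_⟩
  · simpa only [hcoef2] using hsq
  · rw [besovNorm_eq]
    simp only [hcoef2]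
    rw [← Real.sqrt_eq_rpow, ← Real.sqrt_mul (by positivity)]
    refine Real.sqrt_le_sqrt ?_
    rw [div_mul_eq_mul_div, le_div_iff₀ hκ0, mul_comm]
    exact hle.trans hrate
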